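/- **Setting.** An infinitely divisible distribution $P$ on $[0,\infty)$ has a deterministic part (drift) $\alpha\in[0,\infty)$ and a Lévy measure $\nu$, a measure on $(0,\infty)$ with $\int \min(1,x)\,\nu(dx)<\infty$, related to $P$ by the Lévy–Khinchin formula $$-\log\Big(\int e^{-tx}\,P(dx)\Big)=\alpha t+\int_{(0,\infty)}\big(1-e^{-tx}\big)\,\nu(dx)\qquad\text{for all }t\ge 0 .$$ A Poisson point process with rate $1$ on $(0,\infty)$ is a random measure $X$ on $(0,\infty)$, integer valued on bounded sets, such that for every bounded measurable $A\subset(0,\infty)$ the variable $X(A)$ is Poisson distributed with parameter the Lebesgue measure of $A$, and such that the values of $X$ on pairwise disjoint measurable sets are independent. **Lemma.** Let $P_1,P_2$ be infinitely divisible distributions on $[0,\infty)$ with deterministic parts $\alpha_1,\alpha_2$ and Lévy measures $\nu_1,\nu_2$. Assume that $\alpha_1\le\alpha_2$ and $$\nu_1([x,\infty))\le\nu_2([x,\infty))\qquad\text{for all }x>0 .$$ Then there exist random variables $Z_1,Z_2$ on a common probability space, with distributions $P_1$ and $P_2$ respectively, such that $Z_1\le Z_2$ almost surely. Moreover, the probability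 space and $Z_1,Z_2$ can be chosen so that the space carries a Poisson point process $X$ with rate $1$ on $(0,\infty)$ and, for $i=1,2$, almost surely $$Z_i=\alpha_i+\int_{(0,\infty)} G_i^{-1}(y)\,X(dy)<\infty,\qquad G_i^{-1}(y):=\inf\{x\ge 0:\ G_i(x)\le y\},\quad G_i(x):=\nu_i([x,\infty)),$$ where $\nu_i$ is regarded as a measure on $[0,\infty)$ with $\nu_i(\{0\})=0$. In particular $P_1\le_{\mathrm{st}}P_2$, that is, $P_1([x,\infty))\le P_2([x,\infty))$ for all $x\in\mathbb R$. -/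

import Mathlib

open MeasureTheory ProbabilityTheory Set

open scoped ENNReal NNReal

/-- A probability measure `P` on `ℝ` is infinitely divisible if, for every `n ≥ 1`, it is the law
of a sum of `n` independent random variables with a common law `Q`. -/
def IsInfinitelyDivisible (P : Measure ℝ) : Prop :=
  ∀ n : ℕ, 1 ≤ n → ∃ Q : Measure ℝ, IsProbabilityMeasure Q ∧
    (Measure.pi (fun _ : Fin n => Q)).map (fun x => ∑ i, x i) = P

/-- `P` is an infinitely divisible distribution on `[0, ∞)`. -/
structure IsInfinitelyDivisibleNonneg (P : Measure ℝ) : Prop where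
  isProbabilityMeasure : IsProbabilityMeasure P
  nonneg : P (Iio 0) = 0
  infinitelyDivisible : IsInfinitelyDivisible P

/-- `ν` is a Lévy measure on `(0, ∞)` (for distributions on the half-line), regarded as a measure
on `ℝ` that does not charge `(-∞, 0]`: `∫ min(1, x) ν(dx) < ∞`. -/
structure IsLevyMeasureOnPos (ν : Measure ℝ) : Prop where
  nonpos_null : ν (Iic 0) = 0
  lintegral_min_lt_top : ∫⁻ x in Ioi 0, min 1 (ENNReal.ofReal x) ∂ν < ∞

/-- `α` is the deterministic part (drift) and `ν` is the Lévy measure of the distribution `P` on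
`[0, ∞)`, i.e. the Lévy–Khinchin formula for the Laplace transform holds. -/
structure HasLevyKhinchin (P : Measure ℝ) (α : ℝ) (ν : Measure ℝ) : Prop where
  drift_nonneg : 0 ≤ α
  isLevyMeasure : IsLevyMeasureOnPos ν
  neg_log_laplace : ∀ t : ℝ, 0 ≤ t →
    -Real.log (∫ x, Real.exp (-(t * x)) ∂P) =
      α * t + ∫ x in Ioi 0, (1 - Real.exp (-(t * x))) ∂ν

/-- Stochastic order of measures on `(0, ∞)` with finite tails. -/
def TailLE (ν₁ ν₂ : Measure ℝ) : Prop :=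
  ∀ x : ℝ, 0 < x → ν₁ (Ici x) ≤ ν₂ (Ici x)

/-- Stochastic order of probability measures on the real line. -/
def StochLE (P Q : Measure ℝ) : Prop :=
  ∀ x : ℝ, P (Ici x) ≤ Q (Ici x)

/-- The inverse `G⁻¹(y) = inf {x ≥ 0 : G(x) ≤ y}`, for `y > 0`, of the tail function
`G(x) = ν([x, ∞))`. -/
noncomputable def tailInv (ν : Measure ℝ) (y : ℝ) : ℝ :=
  sInf {x : ℝ | 0 ≤ x ∧ ν (Ici x) ≤ ENNReal.ofReal y}

/-- `X` is a Poisson point process on `(0, ∞)` with rate `1` on the probability space `(Ω, μ)`: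
a random measure (carried by `(0, ∞)`, with values in `ℕ` on bounded sets) such that `X(A)` is
Poisson distributed with parameter the Lebesgue measure of `A ∩ (0, ∞)` for bounded measurable
`A`, and such that the values of `X` on pairwise disjoint sets are independent. -/
structure IsUnitPoissonPointProcess {Ω : Type*} [MeasurableSpace Ω] (X : Ω → Measure ℝ)
    (μ : Measure Ω) : Prop where
  measurable : Measurable X
  nonpos_null : ∀ ω, X ω (Iic 0) = 0
  integer_valued : ∀ ω, ∀ A : Set ℝ, MeasurableSet A → Bornology.IsBounded A →
    ∃ n : ℕ, X ω A = n
  hasLaw_poisson : ∀ A : Set ℝ, MeasurableSet A → Bornology.IsBounded A →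
    HasLaw (fun ω => X ω A)
      ((poissonMeasure (volume (A ∩ Ioi 0)).toNNReal).map (fun n : ℕ => (n : ℝ≥0∞))) μ
  indep : ∀ (n : ℕ) (A : Fin n → Set ℝ), (∀ i, MeasurableSet (A i)) →
    Pairwise (fun i j => Disjoint (A i) (A j)) → iIndepFun (fun i ω => X ω (A i)) μ

/-- `Z = α + ∫ G⁻¹(y) X(dy)` almost surely, where `G(x) = ν([x, ∞))`; the integral over `(0, ∞)`
is required to be finite almost surely. -/
def IsPoissonIntegral {Ω : Type*} [MeasurableSpace Ω] (X : Ω → Measure ℝ) (μ : Measure Ω)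
    (α : ℝ) (ν : Measure ℝ) (Z : Ω → ℝ) : Prop :=
  ∀ᵐ ω ∂μ, IntegrableOn (tailInv ν) (Ioi 0) (X ω) ∧
    Z ω = α + ∫ y in Ioi 0, tailInv ν y ∂(X ω)

/-!
Both distributions are realized on the probability space of a single Poisson process `X` on
`(0, ∞)`, by `W = α + ∫ G⁻¹ dX` with values in `[0, ∞]`. By the Galois-type relation
`x < G⁻¹(y) ↔ y < ν (x, ∞)`, the inverse `G⁻¹` increases with the tails of `ν`, so that `W₁ ≤ W₂`
holds for every realization of `X`.

It remains to identify the law of `W`. The Laplace functional of the Poisson process,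
`E exp (-∫ f dX) = exp (-∫ (1 - e^{-f(y)}) dy)` (`lintegral_expNeg_poissonPoints`), and the change
of variables `x = G⁻¹(y)` (`IsLevyMeasureOnPos.lintegral_one_sub_expNeg_tailInv`) show that `W` has
the Laplace transform of `P` at all integers. A finite measure on `[0, ∞]` is determined by these
values, by Stone–Weierstrass (`Measure.ext_of_lintegral_expNeg`). As `P` is carried by `[0, ∞)`,
almost sure finiteness of `W` comes for free.

The process is built cell by cell: independently for each `n`, the interval `(n, n + 1]` receives a
Poisson number of independent uniform points. Its Laplace functional at linear combinations of
indicators gives the joint Laplace transform of the numbers of points in disjoint sets, and the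
multivariate uniqueness theorem (`Measure.ext_of_lintegral_expNeg_sum`) turns this into the Poisson
laws and the independence. Working with `e^{-a}` on `[0, ∞]`, where `e^{-∞} = 0`, keeps infinite
numbers of points and infinite integrals within the scope of the same formulas.
-/

/-! ### The function `e^{-a}` on `[0, ∞]` -/

/-- The function `a ↦ e^{-a}` on `[0, ∞]`, with values in `[0, 1]` and `e^{-∞} = 0`. -/
noncomputable def expNeg (a : ℝ≥0∞) : ℝ≥0∞ := (EReal.exp a)⁻¹

lemma expNeg_zero : expNeg 0 = 1 := by simp [expNeg]

lemma expNeg_add (a b : ℝ≥0∞) : expNeg (a + b) = expNeg a * expNeg b := by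
  have h (c : ℝ≥0∞) : EReal.exp c ≠ 0 := by simp
  rw [expNeg, EReal.coe_ennreal_add, EReal.exp_add,
    ENNReal.mul_inv (Or.inl (h a)) (Or.inr (h b)), expNeg, expNeg]

lemma expNeg_sum {ι : Type*} (s : Finset ι) (a : ι → ℝ≥0∞) :
    expNeg (∑ i ∈ s, a i) = ∏ i ∈ s, expNeg (a i) := by
  induction s using Finset.cons_induction with
  | empty => simp [expNeg_zero]
  | cons i s hi ih => rw [Finset.sum_cons, Finset.prod_cons, expNeg_add, ih]

lemma expNeg_natCast_mul (n : ℕ) (a : ℝ≥0∞) : expNeg (n * a) = expNeg a ^ n := by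
  simpa using expNeg_sum (Finset.range n) (fun _ => a)

lemma expNeg_le_one (a : ℝ≥0∞) : expNeg a ≤ 1 := by
  simpa [expNeg] using EReal.coe_ennreal_nonneg a

lemma expNeg_ne_top (a : ℝ≥0∞) : expNeg a ≠ ∞ :=
  ((expNeg_le_one a).trans_lt ENNReal.one_lt_top).ne

lemma expNeg_injective : Function.Injective expNeg := fun a b h => by
  simpa [expNeg, EReal.exp_strictMono.injective.eq_iff] using h

lemma continuous_expNeg : Continuous expNeg := by
  unfold expNeg
  exact continuous_inv.comp (ENNReal.continuous_exp.comp continuous_coe_ennreal_ereal)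

lemma measurable_expNeg : Measurable expNeg := continuous_expNeg.measurable

lemma expNeg_ofReal {x : ℝ} (hx : 0 ≤ x) :
    expNeg (ENNReal.ofReal x) = ENNReal.ofReal (Real.exp (-x)) := by
  rw [expNeg, EReal.coe_ennreal_ofReal, max_eq_left hx, EReal.exp_coe, Real.exp_neg,
    ENNReal.ofReal_inv_of_pos (Real.exp_pos x)]

/-! ### Uniqueness of Laplace transforms on `[0, ∞]^ι` -/

/-- A finite measure on `[0, ∞]^ι` is determined by its Laplace transform at integer arguments.
The functions `x ↦ e^{-⟨m, x⟩}` span a point-separating algebra of continuous functions on the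
compact space `[0, ∞]^ι`. -/
theorem Measure.ext_of_lintegral_expNeg_sum {ι : Type*} [Fintype ι] {P Q : Measure (ι → ℝ≥0∞)}
    [IsFiniteMeasure P] [IsFiniteMeasure Q]
    (h : ∀ m : ι → ℕ, ∫⁻ x, expNeg (∑ i, m i * x i) ∂P = ∫⁻ x, expNeg (∑ i, m i * x i) ∂Q) :
    P = Q := by
  have hc (i : ι) : Continuous fun x : ι → ℝ≥0∞ => (expNeg (x i)).toReal :=
    ENNReal.continuousOn_toReal.comp_continuous
      (continuous_expNeg.comp (continuous_apply i)) fun x => expNeg_ne_top _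
  let g (i : ι) : BoundedContinuousFunction (ι → ℝ≥0∞) ℝ :=
    BoundedContinuousFunction.mkOfCompact ⟨_, hc i⟩
  have hg (i : ι) (x : ι → ℝ≥0∞) : g i x = (expNeg (x i)).toReal := rfl
  let A : StarSubalgebra ℝ (BoundedContinuousFunction (ι → ℝ≥0∞) ℝ) :=
    { Algebra.adjoin ℝ (range g) with
      star_mem' := fun {f} hf => by
        have : star f = f := by ext x; simp
        rwa [this] }
  refine ext_of_forall_mem_subalgebra_integral_eq_of_polish (𝕜 := ℝ) (A := A) ?_ ?_
  · intro x y hxy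
    obtain ⟨i, hi⟩ := Function.ne_iff.1 hxy
    refine ⟨g i, ⟨⟨(g i).toContinuousMap, ⟨g i, ?_, rfl⟩, rfl⟩, ?_⟩⟩
    · exact Algebra.subset_adjoin (mem_range_self i)
    · change (expNeg (x i)).toReal ≠ (expNeg (y i)).toReal
      rw [Ne, ENNReal.toReal_eq_toReal_iff' (expNeg_ne_top _) (expNeg_ne_top _)]
      exact fun h => hi (expNeg_injective h)
  · intro f hf
    have hf' : f ∈ Submodule.span ℝ (Submonoid.closure (range g) :
        Set (BoundedContinuousFunction (ι → ℝ≥0∞) ℝ)) := by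
      rw [← Algebra.adjoin_eq_span]; exact hf
    clear hf
    induction hf' using Submodule.span_induction with
    | mem f hf =>
      -- A product of the generators is again a function `x ↦ e^{-⟨m, x⟩}`.
      have : ∃ m : ι → ℕ, ∀ x, f x = (expNeg (∑ i, m i * x i)).toReal := by
        induction hf using Submonoid.closure_induction with
        | mem f hf =>
          classical
          obtain ⟨i, rfl⟩ := hf
          exact ⟨Pi.single i 1, fun x => by simp [hg, Pi.single_apply]⟩
        | one => exact ⟨0, fun x => by simp [expNeg_zero]⟩
        | mul f f' _ _ h h' =>
          obtain ⟨m, hm⟩ := h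
          obtain ⟨m', hm'⟩ := h'
          refine ⟨m + m', fun x => ?_⟩
          simp [hm, hm', add_mul, Finset.sum_add_distrib, expNeg_add]
      obtain ⟨m, hm⟩ := this
      have hmeas : Measurable fun x : ι → ℝ≥0∞ => expNeg (∑ i, m i * x i) :=
        measurable_expNeg.comp (by fun_prop)
      simp_rw [hm]
      rw [integral_toReal hmeas.aemeasurable (.of_forall fun x => (expNeg_ne_top _).lt_top),
        integral_toReal hmeas.aemeasurable (.of_forall fun x => (expNeg_ne_top _).lt_top), h]
    | zero => simp
    | add f f' _ _ h h' =>
      simp only [BoundedContinuousFunction.coe_add, Pi.add_apply]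
      rw [integral_add (f.integrable _) (f'.integrable _),
        integral_add (f.integrable _) (f'.integrable _), h, h']
    | smul c f _ h =>
      simp only [BoundedContinuousFunction.coe_smul, integral_smul]
      rw [h]

/-- A finite measure on `[0, ∞]` is determined by its Laplace transform at integer arguments. -/
theorem Measure.ext_of_lintegral_expNeg {P Q : Measure ℝ≥0∞} [IsFiniteMeasure P]
    [IsFiniteMeasure Q] (h : ∀ m : ℕ, ∫⁻ x, expNeg (m * x) ∂P = ∫⁻ x, expNeg (m * x) ∂Q) :
    P = Q := by
  have e := (MeasurableEquiv.funUnique Unit ℝ≥0∞).symm.measurableEmbedding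
  refine e.map_injective ?_
  have : IsFiniteMeasure (P.map (MeasurableEquiv.funUnique Unit ℝ≥0∞).symm) := inferInstance
  refine Measure.ext_of_lintegral_expNeg_sum fun m => ?_
  rw [e.lintegral_map, e.lintegral_map]
  simpa using h (m ())

/-! ### Construction of the Poisson process -/

/-- The uniform distribution on the cell `(n, n + 1]`. -/
noncomputable def cellUniform (n : ℕ) : Measure ℝ := volume.restrict (Ioc (n : ℝ) (n + 1))

instance (n : ℕ) : IsProbabilityMeasure (cellUniform n) :=
  ⟨by simp [cellUniform]⟩

/-- The sample space of the Poisson process: in each cell `(n, n + 1]`, a number of points and a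
sequence of positions, of which only the first ones are used. -/
abbrev PoissonSpace : Type := ℕ → ℕ × (ℕ → ℝ)

/-- The law of the number and the positions of the points in the cell `(n, n + 1]`: a Poisson
number with parameter `1`, and independent uniform positions. -/
noncomputable def cellLaw (n : ℕ) : Measure (ℕ × (ℕ → ℝ)) :=
  (poissonMeasure 1).prod (Measure.infinitePi fun _ : ℕ => cellUniform n)

instance (n : ℕ) : IsProbabilityMeasure (cellLaw n) := by
  unfold cellLaw; infer_instance

/-- The law on `PoissonSpace` under which the cells are independent. -/
noncomputable def poissonSpaceLaw : Measure PoissonSpace := Measure.infinitePi cellLaw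

instance : IsProbabilityMeasure poissonSpaceLaw := by
  unfold poissonSpaceLaw; infer_instance

/-- The point process that puts the points prescribed by `ω n` in the cell `(n, n + 1]`. Positions
outside the cell, which have probability zero, are discarded, so that every realization is a
locally finite counting measure on `(0, ∞)`. -/
noncomputable def poissonPoints (ω : PoissonSpace) : Measure ℝ :=
  Measure.sum fun n => ∑ k ∈ Finset.range (ω n).1,
    (Measure.dirac ((ω n).2 k)).restrict (Ioc (n : ℝ) (n + 1))

lemma lintegral_poissonPoints {f : ℝ → ℝ≥0∞} (hf : Measurable f) (ω : PoissonSpace) :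
    ∫⁻ y, f y ∂poissonPoints ω =
      ∑' n : ℕ, ∑ k ∈ Finset.range (ω n).1, (Ioc (n : ℝ) (n + 1)).indicator f ((ω n).2 k) := by
  classical
  rw [poissonPoints, lintegral_sum_measure]
  congr! 2 with n
  rw [lintegral_finsetSum_measure]
  congr! 1 with k
  rw [setLIntegral_dirac' hf measurableSet_Ioc, indicator_apply]

lemma measurable_sum_range_fst {g : ℝ → ℝ≥0∞} (hg : Measurable g) :
    Measurable fun p : ℕ × (ℕ → ℝ) => ∑ k ∈ Finset.range p.1, g (p.2 k) :=
  measurable_from_prod_countable_right fun N => by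
    dsimp only
    fun_prop

lemma measurable_poissonPoints : Measurable poissonPoints := by
  refine Measure.measurable_of_measurable_coe _ fun s hs => ?_
  have h (ω : PoissonSpace) : poissonPoints ω s = ∑' n : ℕ, ∑ k ∈ Finset.range (ω n).1,
      (Ioc (n : ℝ) (n + 1)).indicator (s.indicator 1) ((ω n).2 k) := by
    rw [← lintegral_poissonPoints (measurable_one.indicator hs), lintegral_indicator_one hs]
  simp_rw [h]
  exact .tsum fun n => (measurable_sum_range_fst
    ((measurable_one.indicator hs).indicator measurableSet_Ioc)).comp (measurable_pi_apply n)

lemma iUnion_Ioc_natCast_add_one : ⋃ n : ℕ, Ioc (n : ℝ) (n + 1) = Ioi 0 := by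
  ext x
  simp only [mem_iUnion, mem_Ioc, mem_Ioi]
  constructor
  · rintro ⟨n, hn, -⟩
    exact n.cast_nonneg.trans_lt hn
  · intro hx
    obtain ⟨n, hn⟩ := Nat.exists_eq_add_one.2 (Nat.ceil_pos.2 hx)
    refine ⟨n, Nat.lt_ceil.1 (by omega), ?_⟩
    have := Nat.le_ceil x
    rw [hn] at this
    exact_mod_cast this

lemma pairwise_disjoint_Ioc_natCast :
    Pairwise (Function.onFun Disjoint fun n : ℕ => Ioc (n : ℝ) (n + 1)) := by
  intro m n hmn
  refine Set.disjoint_left.2 fun x hx hx' => ?_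
  rcases hmn.lt_or_gt with h | h
  · have : (m : ℝ) + 1 ≤ n := by exact_mod_cast h
    linarith [hx.2, hx'.1]
  · have : (n : ℝ) + 1 ≤ m := by exact_mod_cast h
    linarith [hx'.2, hx.1]

lemma poissonPoints_Iic (ω : PoissonSpace) : poissonPoints ω (Iic 0) = 0 := by
  rw [← lintegral_indicator_one measurableSet_Iic,
    lintegral_poissonPoints (measurable_one.indicator measurableSet_Iic)]
  refine ENNReal.tsum_eq_zero.2 fun n => Finset.sum_eq_zero fun k _ => ?_
  rw [indicator_indicator, indicator_of_notMem]
  rintro ⟨h, h'⟩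
  exact absurd (h.1.trans_le h') (by simp)

lemma exists_natCast_eq_poissonPoints (ω : PoissonSpace) {s : Set ℝ} (hs : MeasurableSet s)
    (hb : Bornology.IsBounded s) : ∃ n : ℕ, poissonPoints ω s = n := by
  classical
  obtain ⟨M, hM⟩ := hb.bddAbove
  obtain ⟨K, hK⟩ := exists_nat_ge M
  rw [← lintegral_indicator_one hs, lintegral_poissonPoints (measurable_one.indicator hs),
    tsum_eq_sum (s := Finset.range K)]
  · refine ⟨∑ n ∈ Finset.range K, ∑ k ∈ Finset.range (ω n).1,
      if (ω n).2 k ∈ Ioc (n : ℝ) (n + 1) ∩ s then 1 else 0, ?_⟩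
    push_cast
    simp only [indicator_apply, Pi.one_apply, mem_inter_iff, ite_and]
  · intro n hn
    have hn : (K : ℝ) ≤ n := by simpa using hn
    refine Finset.sum_eq_zero fun k _ => ?_
    rw [indicator_indicator, indicator_of_notMem]
    rintro ⟨h, h'⟩
    linarith [hM h', h.1]

/-! ### The Laplace functional of the Poisson process -/

lemma lintegral_pow_poissonMeasure (r : ℝ≥0) {b : ℝ≥0∞} (hb : b ≤ 1) :
    ∫⁻ n, b ^ n ∂poissonMeasure r = expNeg (r * (1 - b)) := by
  lift b to ℝ≥0 using (hb.trans_lt ENNReal.one_lt_top).ne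
  have hb' : (b : ℝ) ≤ 1 := by exact_mod_cast hb
  have h1 : (r : ℝ≥0∞) * (1 - b) = ENNReal.ofReal (r * (1 - b)) := by
    rw [ENNReal.ofReal_mul r.coe_nonneg, ENNReal.ofReal_sub _ b.coe_nonneg]
    simp
  rw [h1, expNeg_ofReal (mul_nonneg r.coe_nonneg (sub_nonneg.2 hb')), lintegral_countable']
  have h2 (n : ℕ) : (b : ℝ≥0∞) ^ n * poissonMeasure r {n} =
      ENNReal.ofReal (Real.exp (-r) * ((r * b) ^ n / n.factorial)) := by
    rw [poissonMeasure_singleton, ← ENNReal.ofReal_coe_nnreal, ← ENNReal.ofReal_pow b.coe_nonneg,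
      ← ENNReal.ofReal_mul (by positivity)]
    congr 1; ring
  have h3 : HasSum (fun n : ℕ => Real.exp (-r) * ((r * b : ℝ) ^ n / n.factorial))
      (Real.exp (-(r * (1 - b)))) := by
    rw [show -((r : ℝ) * (1 - b)) = -r + r * b by ring, Real.exp_add, Real.exp_eq_exp_ℝ]
    exact (NormedSpace.expSeries_div_hasSum_exp (r * b : ℝ)).mul_left _
  simp_rw [h2]
  rw [← ENNReal.ofReal_tsum_of_nonneg (fun n => by positivity) h3.summable, h3.tsum_eq]

/-- The Laplace functional of a Poisson number of independent points. -/
lemma lintegral_expNeg_cellLaw {g : ℝ → ℝ≥0∞} (hg : Measurable g) (n : ℕ) :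
    ∫⁻ p, expNeg (∑ k ∈ Finset.range p.1, g (p.2 k)) ∂cellLaw n =
      expNeg (∫⁻ y, (1 - expNeg (g y)) ∂cellUniform n) := by
  have hg' : Measurable fun y => expNeg (g y) := measurable_expNeg.comp hg
  have hle : ∫⁻ y, expNeg (g y) ∂cellUniform n ≤ 1 :=
    (lintegral_mono fun y => expNeg_le_one _).trans (by simp)
  have h1 (N : ℕ) : ∫⁻ u : ℕ → ℝ, expNeg (∑ k ∈ Finset.range N, g (u k))
      ∂Measure.infinitePi (fun _ : ℕ => cellUniform n) =
      (∫⁻ y, expNeg (g y) ∂cellUniform n) ^ N := by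
    simp_rw [expNeg_sum]
    rw [lintegral_prod_eq_prod_lintegral_of_indepFun (Finset.range N)
      (fun k (u : ℕ → ℝ) => expNeg (g (u k)))
      (iIndepFun_infinitePi (X := fun _ y => expNeg (g y)) fun _ => hg')
      fun k => hg'.comp (measurable_pi_apply k)]
    have h2 (k : ℕ) : ∫⁻ u : ℕ → ℝ, expNeg (g (u k))
        ∂Measure.infinitePi (fun _ : ℕ => cellUniform n) = ∫⁻ y, expNeg (g y) ∂cellUniform n :=
      (measurePreserving_eval_infinitePi (fun _ : ℕ => cellUniform n) k).lintegral_comp hg'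
    simp [h2]
  have hm : Measurable fun p : ℕ × (ℕ → ℝ) => expNeg (∑ k ∈ Finset.range p.1, g (p.2 k)) :=
    measurable_expNeg.comp (measurable_sum_range_fst hg)
  rw [cellLaw, lintegral_prod _ hm.aemeasurable]
  simp_rw [h1]
  rw [lintegral_pow_poissonMeasure 1 hle, lintegral_sub hg' (hle.trans_lt ENNReal.one_lt_top).ne
    (.of_forall fun y => expNeg_le_one _)]
  simp

/-- The Laplace functional of the Poisson process: for measurable `f ≥ 0`,
`E exp (-∫ f dX) = exp (-∫ (1 - e^{-f(y)}) dy)`. -/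
theorem lintegral_expNeg_poissonPoints {f : ℝ → ℝ≥0∞} (hf : Measurable f) :
    ∫⁻ ω, expNeg (∫⁻ y, f y ∂poissonPoints ω) ∂poissonSpaceLaw =
      expNeg (∫⁻ y in Ioi 0, (1 - expNeg (f y))) := by
  let g (n : ℕ) : ℝ → ℝ≥0∞ := (Ioc (n : ℝ) (n + 1)).indicator f
  have hg (n : ℕ) : Measurable (g n) := hf.indicator measurableSet_Ioc
  let S (n : ℕ) (p : ℕ × (ℕ → ℝ)) : ℝ≥0∞ := ∑ k ∈ Finset.range p.1, g n (p.2 k)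
  have hS (n : ℕ) : Measurable (S n) := measurable_sum_range_fst (hg n)
  have hS' (n : ℕ) : Measurable fun p => expNeg (S n p) := measurable_expNeg.comp (hS n)
  let c (n : ℕ) : ℝ≥0∞ := ∫⁻ y in Ioc (n : ℝ) (n + 1), (1 - expNeg (f y))
  have hc (n : ℕ) : ∫⁻ ω : PoissonSpace, expNeg (S n (ω n)) ∂poissonSpaceLaw = expNeg (c n) := by
    refine ((measurePreserving_eval_infinitePi cellLaw n).lintegral_comp (hS' n)).trans
      ((lintegral_expNeg_cellLaw (hg n) n).trans ?_)
    congr 1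
    refine setLIntegral_congr_fun measurableSet_Ioc fun y hy => ?_
    simp only [g, indicator_of_mem hy]
  have hfin (M : ℕ) : ∫⁻ ω : PoissonSpace, expNeg (∑ n ∈ Finset.range M, S n (ω n))
      ∂poissonSpaceLaw = expNeg (∑ n ∈ Finset.range M, c n) := by
    simp_rw [expNeg_sum]
    rw [poissonSpaceLaw, lintegral_prod_eq_prod_lintegral_of_indepFun (Finset.range M)
      (fun n (ω : PoissonSpace) => expNeg (S n (ω n)))
      (iIndepFun_infinitePi (X := fun n p => expNeg (S n p))
        hS')
      fun n => (hS' n).comp (measurable_pi_apply n)]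
    exact Finset.prod_congr rfl fun n _ => hc n
  have hlim : Filter.Tendsto (fun M => ∫⁻ ω : PoissonSpace,
      expNeg (∑ n ∈ Finset.range M, S n (ω n)) ∂poissonSpaceLaw) Filter.atTop
      (nhds (∫⁻ ω : PoissonSpace, expNeg (∑' n, S n (ω n)) ∂poissonSpaceLaw)) := by
    refine tendsto_lintegral_of_dominated_convergence 1 (fun M => measurable_expNeg.comp
      (Finset.measurable_sum _ fun n _ => (hS n).comp (measurable_pi_apply n)))
      (fun M => .of_forall fun ω => expNeg_le_one _) (by simp) (.of_forall fun ω => ?_)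
    exact (continuous_expNeg.tendsto _).comp (ENNReal.tendsto_nat_tsum _)
  have hlim' : Filter.Tendsto (fun M => expNeg (∑ n ∈ Finset.range M, c n)) Filter.atTop
      (nhds (expNeg (∑' n, c n))) :=
    (continuous_expNeg.tendsto _).comp (ENNReal.tendsto_nat_tsum _)
  simp_rw [hfin] at hlim
  simp_rw [lintegral_poissonPoints hf]
  refine (tendsto_nhds_unique hlim hlim').trans ?_
  rw [← iUnion_Ioc_natCast_add_one,
    lintegral_iUnion (fun _ => measurableSet_Ioc) pairwise_disjoint_Ioc_natCast]

/-! ### Numbers of points in disjoint sets -/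

/-- The joint Laplace transform of the numbers of points in disjoint sets. -/
lemma lintegral_expNeg_sum_poissonPoints {ι : Type*} [Fintype ι] {A : ι → Set ℝ}
    (hA : ∀ i, MeasurableSet (A i)) (hd : Pairwise (Function.onFun Disjoint A)) (t : ι → ℝ≥0∞) :
    ∫⁻ ω, expNeg (∑ i, t i * poissonPoints ω (A i)) ∂poissonSpaceLaw =
      ∏ i, expNeg (volume (A i ∩ Ioi 0) * (1 - expNeg (t i))) := by
  have hm (i : ι) : Measurable ((A i).indicator fun _ => t i) :=
    measurable_const.indicator (hA i)
  have h1 (ω : PoissonSpace) : ∑ i, t i * poissonPoints ω (A i) =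
      ∫⁻ y, ∑ i, (A i).indicator (fun _ => t i) y ∂poissonPoints ω := by
    rw [lintegral_finsetSum _ fun i _ => hm i]
    simp [lintegral_indicator, hA]
  have h2 (y : ℝ) : 1 - expNeg (∑ i, (A i).indicator (fun _ => t i) y) =
      ∑ i, (A i).indicator (fun _ => 1 - expNeg (t i)) y := by
    -- By disjointness, at most one term of each sum is nonzero.
    by_cases hy : ∃ i, y ∈ A i
    · obtain ⟨i, hi⟩ := hy
      have hj (j : ι) (hji : j ≠ i) : y ∉ A j := fun hj => (hd hji).le_bot ⟨hj, hi⟩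
      rw [Finset.sum_eq_single i (fun j _ hji => indicator_of_notMem (hj j hji) _) (by simp),
        Finset.sum_eq_single i (fun j _ hji => indicator_of_notMem (hj j hji) _) (by simp),
        indicator_of_mem hi, indicator_of_mem hi]
    · push Not at hy
      simp [hy, expNeg_zero]
  simp_rw [h1]
  rw [lintegral_expNeg_poissonPoints (Finset.measurable_sum _ fun i _ => hm i)]
  simp_rw [h2]
  rw [lintegral_finsetSum _ fun i _ => measurable_const.indicator (hA i), expNeg_sum]
  refine Finset.prod_congr rfl fun i _ => ?_
  rw [lintegral_indicator (hA i), setLIntegral_const, Measure.restrict_apply (hA i), mul_comm]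

theorem isUnitPoissonPointProcess_poissonPoints :
    IsUnitPoissonPointProcess poissonPoints poissonSpaceLaw where
  measurable := measurable_poissonPoints
  nonpos_null := poissonPoints_Iic
  integer_valued ω _ hA hb := exists_natCast_eq_poissonPoints ω hA hb
  hasLaw_poisson A hA hb := by
    have hX : Measurable fun ω => poissonPoints ω A :=
      (Measure.measurable_coe hA).comp measurable_poissonPoints
    refine ⟨hX.aemeasurable, ?_⟩
    have := Measure.isProbabilityMeasure_map (μ := poissonSpaceLaw) hX.aemeasurable
    have hfin : volume (A ∩ Ioi 0) ≠ ∞ :=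
      ((measure_mono inter_subset_left).trans_lt hb.measure_lt_top).ne
    refine Measure.ext_of_lintegral_expNeg fun m => ?_
    have hm : Measurable fun x : ℝ≥0∞ => expNeg (m * x) := measurable_expNeg.comp (by fun_prop)
    rw [lintegral_map hm hX, lintegral_map hm .of_discrete]
    have h1 := lintegral_expNeg_sum_poissonPoints (ι := Unit) (A := fun _ => A) (fun _ => hA)
      (fun i j hij => (hij rfl).elim) fun _ => (m : ℝ≥0∞)
    simp only [Finset.univ_unique, Finset.sum_singleton, Finset.prod_singleton] at h1
    have h2 (n : ℕ) : expNeg (m * n) = expNeg m ^ n := by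
      rw [mul_comm, expNeg_natCast_mul]
    simp_rw [h1, h2]
    rw [lintegral_pow_poissonMeasure _ (expNeg_le_one _), ENNReal.coe_toNNReal hfin]
  indep n A hA hd := by
    have hX (i : Fin n) : Measurable fun ω => poissonPoints ω (A i) :=
      (Measure.measurable_coe (hA i)).comp measurable_poissonPoints
    rw [iIndepFun_iff_map_fun_eq_pi_map fun i => (hX i).aemeasurable]
    have := Measure.isProbabilityMeasure_map (μ := poissonSpaceLaw)
      (measurable_pi_lambda _ hX).aemeasurable
    have := fun i => Measure.isProbabilityMeasure_map (μ := poissonSpaceLaw) (hX i).aemeasurable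
    refine Measure.ext_of_lintegral_expNeg_sum fun m => ?_
    have hm (i : Fin n) : Measurable fun x : ℝ≥0∞ => expNeg (m i * x) :=
      measurable_expNeg.comp (by fun_prop)
    have hm' : Measurable fun x : Fin n → ℝ≥0∞ => expNeg (∑ i, m i * x i) :=
      measurable_expNeg.comp (by fun_prop)
    rw [lintegral_map hm' (measurable_pi_lambda _ hX),
      lintegral_expNeg_sum_poissonPoints hA (fun i j hij => hd hij) fun i => (m i : ℝ≥0∞)]
    simp_rw [expNeg_sum]
    rw [lintegral_prod_eq_prod_lintegral_of_indepFun Finset.univ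
      (fun i (x : Fin n → ℝ≥0∞) => expNeg (m i * x i))
      (iIndepFun_pi (X := fun i x => expNeg (m i * x)) fun i => (hm i).aemeasurable)
      fun i => (hm i).comp (measurable_pi_apply i)]
    refine Finset.prod_congr rfl fun i _ => ?_
    have h1 := lintegral_expNeg_sum_poissonPoints (ι := Unit) (A := fun _ => A i)
      (fun _ => hA i) (fun i j hij => (hij rfl).elim) fun _ => (m i : ℝ≥0∞)
    simp only [Finset.univ_unique, Finset.sum_singleton, Finset.prod_singleton] at h1
    rw [← h1, ← lintegral_map (hm i) (hX i)]
    exact ((measurePreserving_eval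
      (fun j => poissonSpaceLaw.map fun ω => poissonPoints ω (A j)) i).lintegral_comp (hm i)).symm

/-! ### The generalized inverse of the tail function -/

lemma tailInv_nonneg (ν : Measure ℝ) (y : ℝ) : 0 ≤ tailInv ν y :=
  Real.sInf_nonneg fun _ hx => hx.1

lemma measure_Ioi_eq_iSup_Ici (ν : Measure ℝ) (x : ℝ) :
    ν (Ioi x) = ⨆ n : ℕ, ν (Ici (x + 1 / (n + 1))) := by
  have hU : Ioi x = ⋃ n : ℕ, Ici (x + 1 / ((n : ℝ) + 1)) := by
    ext z
    simp only [mem_Ioi, mem_iUnion, mem_Ici]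
    constructor
    · intro hz
      obtain ⟨n, hn⟩ := exists_nat_one_div_lt (sub_pos.2 hz)
      exact ⟨n, by linarith⟩
    · rintro ⟨n, hn⟩
      have : (0 : ℝ) < 1 / (n + 1) := Nat.one_div_pos_of_nat
      linarith
  rw [hU]
  refine Monotone.measure_iUnion fun m n hmn => Ici_subset_Ici.2 ?_
  have := Nat.one_div_le_one_div (α := ℝ) hmn
  linarith

lemma TailLE.measure_Ioi_le {ν₁ ν₂ : Measure ℝ} (h : TailLE ν₁ ν₂) {x : ℝ} (hx : 0 ≤ x) :
    ν₁ (Ioi x) ≤ ν₂ (Ioi x) := by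
  rw [measure_Ioi_eq_iSup_Ici, measure_Ioi_eq_iSup_Ici]
  exact iSup_mono fun n => h _ (by positivity)

namespace IsLevyMeasureOnPos

variable {ν : Measure ℝ}

lemma measure_Ici_one_lt_top (hν : IsLevyMeasureOnPos ν) : ν (Ici 1) < ∞ := by
  refine lt_of_le_of_lt ?_ hν.lintegral_min_lt_top
  calc ν (Ici 1) = ∫⁻ _ in Ici 1, 1 ∂ν := by simp
    _ ≤ ∫⁻ x in Ici 1, min 1 (ENNReal.ofReal x) ∂ν :=
      setLIntegral_mono' measurableSet_Ici fun x hx => by simpa using hx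
    _ ≤ _ := lintegral_mono_set fun x (hx : 1 ≤ x) => zero_lt_one.trans_le hx

lemma exists_measure_Ici_le (hν : IsLevyMeasureOnPos ν) {y : ℝ} (hy : 0 < y) :
    ∃ x : ℝ, 0 ≤ x ∧ ν (Ici x) ≤ ENNReal.ofReal y := by
  have hlim : Filter.Tendsto (fun n : ℕ => ν (Ici ((n : ℝ) + 1))) Filter.atTop (nhds 0) := by
    have he : ⋂ n : ℕ, Ici ((n : ℝ) + 1) = ∅ := by
      refine eq_empty_of_forall_notMem fun x hx => ?_
      obtain ⟨n, hn⟩ := exists_nat_ge x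
      have : (n : ℝ) + 1 ≤ x := mem_iInter.1 hx n
      linarith
    rw [← measure_empty (μ := ν), ← he]
    refine tendsto_measure_iInter_atTop (fun n => measurableSet_Ici.nullMeasurableSet)
      (fun m n hmn => Ici_subset_Ici.2 (by gcongr)) ⟨0, ?_⟩
    simpa using hν.measure_Ici_one_lt_top.ne
  obtain ⟨n, hn⟩ := (hlim.eventually_le_const (ENNReal.ofReal_pos.2 hy)).exists
  exact ⟨n + 1, by positivity, hn⟩

/-- The Galois-type relation between the generalized inverse and the right-continuous version
`x ↦ ν (x, ∞)` of the tail function. -/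
lemma lt_tailInv_iff (hν : IsLevyMeasureOnPos ν) {x y : ℝ} (hx : 0 ≤ x) (hy : 0 < y) :
    x < tailInv ν y ↔ ENNReal.ofReal y < ν (Ioi x) := by
  constructor
  · contrapose!
    intro h
    refine le_of_forall_gt_imp_ge_of_dense fun z hz => ?_
    exact csInf_le ⟨0, fun _ hw => hw.1⟩
      ⟨hx.trans hz.le, (measure_mono (Ici_subset_Ioi.2 hz)).trans h⟩
  · intro h
    rw [measure_Ioi_eq_iSup_Ici, lt_iSup_iff] at h
    obtain ⟨n, hn⟩ := h
    have hpos : (0 : ℝ) < 1 / (n + 1) := Nat.one_div_pos_of_nat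
    refine (lt_add_of_pos_right x hpos).trans_le ?_
    refine le_csInf (hν.exists_measure_Ici_le hy) fun z hz => ?_
    by_contra! hlt
    exact absurd (hn.trans_le (measure_mono (Ici_subset_Ici.2 hlt.le))) hz.2.not_gt

lemma measurable_indicator_tailInv (hν : IsLevyMeasureOnPos ν) :
    Measurable ((Ioi 0).indicator (tailInv ν)) := by
  refine measurable_of_Ioi fun x => ?_
  rcases lt_or_ge x 0 with hx | hx
  · convert MeasurableSet.univ
    refine eq_univ_of_forall fun y => ?_
    exact hx.trans_le (indicator_nonneg (fun y _ => tailInv_nonneg ν y) y)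
  · have : (Ioi 0).indicator (tailInv ν) ⁻¹' Ioi x =
        Ioi 0 ∩ ENNReal.ofReal ⁻¹' Iio (ν (Ioi x)) := by
      ext y
      by_cases hy : 0 < y
      · simp [hy, hν.lt_tailInv_iff hx hy]
      · simp [hy, hx]
    rw [this]
    exact measurableSet_Ioi.inter (ENNReal.measurable_ofReal measurableSet_Iio)

/-- The generalized inverse pushes Lebesgue measure on `(0, ∞)` forward to a measure with the same
tails `x ↦ ν (x, ∞)`. -/
lemma volume_restrict_lt_tailInv (hν : IsLevyMeasureOnPos ν) {x : ℝ} (hx : 0 ≤ x) :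
    volume.restrict (Ioi 0) {y | x < tailInv ν y} = ν (Ioi x) := by
  have h : volume.restrict (Ioi 0) {y | x < tailInv ν y} =
      volume {y : ℝ | 0 < y ∧ ENNReal.ofReal y < ν (Ioi x)} := by
    rw [Measure.restrict_apply' measurableSet_Ioi]
    congr 1
    ext y
    simp only [mem_inter_iff, mem_ofPred_eq, mem_Ioi]
    exact ⟨fun h => ⟨h.2, (hν.lt_tailInv_iff hx h.2).1 h.1⟩,
      fun h => ⟨(hν.lt_tailInv_iff hx h.1).2 h.2, h.1⟩⟩
  rw [h]
  by_cases htop : ν (Ioi x) = ∞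
  · simp only [htop, ENNReal.ofReal_lt_top, and_true]
    exact Real.volume_Ioi
  · have : {y : ℝ | 0 < y ∧ ENNReal.ofReal y < ν (Ioi x)} = Ioo 0 (ν (Ioi x)).toReal := by
      ext y
      simp only [mem_ofPred_eq, mem_Ioo]
      refine and_congr_right fun hy => ?_
      rw [ENNReal.ofReal_lt_iff_lt_toReal hy.le htop]
    rw [this, Real.volume_Ioo, sub_zero, ENNReal.ofReal_toReal htop]

/-! ### Change of variables in the Lévy–Khinchin integral -/

lemma one_sub_expNeg_eq_ofReal_integral (m : ℕ) {x : ℝ} (hx : 0 ≤ x) :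
    1 - expNeg (m * ENNReal.ofReal x) =
      ENNReal.ofReal (∫ s in (0 : ℝ)..x, m * Real.exp (-(m * s))) := by
  have hd (s : ℝ) : HasDerivAt (fun s : ℝ => -Real.exp (-(m * s))) (m * Real.exp (-(m * s))) s := by
    have := (((hasDerivAt_id s).const_mul (m : ℝ)).neg.exp).neg
    simp only [id, mul_one] at this
    exact this.congr_deriv (by simp only [Pi.neg_apply]; ring)
  rw [intervalIntegral.integral_eq_sub_of_hasDerivAt (fun s _ => hd s)
    ((by fun_prop : Continuous fun s : ℝ => m * Real.exp (-(m * s))).intervalIntegrable _ _),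
    ← ENNReal.ofReal_natCast, ← ENNReal.ofReal_mul m.cast_nonneg, expNeg_ofReal (by positivity),
    ← ENNReal.ofReal_one, ← ENNReal.ofReal_sub _ (Real.exp_pos _).le]
  congr 1
  simp
  ring

/-- Change of variables `x = G⁻¹(y)` in the Lévy–Khinchin integral, by the layer cake formula. -/
lemma lintegral_one_sub_expNeg_tailInv (hν : IsLevyMeasureOnPos ν) (m : ℕ) :
    ∫⁻ y in Ioi 0, (1 - expNeg (m * ENNReal.ofReal (tailInv ν y))) =
      ∫⁻ x in Ioi 0, (1 - expNeg (m * ENNReal.ofReal x)) ∂ν := by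
  have hc : Continuous fun s : ℝ => m * Real.exp (-(m * s)) := by fun_prop
  have hnn : ∀ᵐ s : ℝ ∂volume.restrict (Ioi 0), 0 ≤ m * Real.exp (-(m * s)) :=
    .of_forall fun s => by positivity
  have hl := lintegral_comp_eq_lintegral_meas_lt_mul (volume.restrict (Ioi (0 : ℝ)))
    (.of_forall (tailInv_nonneg ν))
    ((aemeasurable_indicator_iff measurableSet_Ioi).1 hν.measurable_indicator_tailInv.aemeasurable)
    (fun t _ => hc.intervalIntegrable _ _) hnn
  have hr := lintegral_comp_eq_lintegral_meas_lt_mul (ν.restrict (Ioi (0 : ℝ))) (f := id)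
    ((ae_restrict_iff' measurableSet_Ioi).2 (.of_forall fun x hx => le_of_lt hx))
    measurable_id.aemeasurable (fun t _ => hc.intervalIntegrable _ _) hnn
  calc _ = _ := by
        simp_rw [fun y => one_sub_expNeg_eq_ofReal_integral m (tailInv_nonneg ν y)]
        exact hl
    _ = _ := by
        refine setLIntegral_congr_fun measurableSet_Ioi fun s hs => ?_
        have hs' : (0 : ℝ) ≤ s := le_of_lt hs
        rw [hν.volume_restrict_lt_tailInv hs']
        congr 1
        rw [Measure.restrict_apply' measurableSet_Ioi]
        congr 1
        ext x
        exact ⟨fun h => ⟨h, hs'.trans_lt h⟩, fun h => h.1⟩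
    _ = _ := hr.symm
    _ = _ := setLIntegral_congr_fun measurableSet_Ioi fun x hx =>
        (one_sub_expNeg_eq_ofReal_integral m (le_of_lt hx)).symm

lemma ofReal_integral_one_sub_exp (hν : IsLevyMeasureOnPos ν) (m : ℕ) :
    ENNReal.ofReal (∫ x in Ioi 0, (1 - Real.exp (-(m * x))) ∂ν) =
      ∫⁻ x in Ioi 0, (1 - expNeg (m * ENNReal.ofReal x)) ∂ν := by
  have hnn : ∀ᵐ x ∂ν.restrict (Ioi 0), 0 ≤ 1 - Real.exp (-(m * x)) := by
    refine (ae_restrict_iff' measurableSet_Ioi).2 (.of_forall fun x (hx : 0 < x) => ?_)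
    have : 0 ≤ (m : ℝ) * x := by positivity
    simpa using this
  have hle : ∫⁻ x in Ioi 0, ENNReal.ofReal (1 - Real.exp (-(m * x))) ∂ν < ∞ := by
    refine lt_of_le_of_lt (setLIntegral_mono' measurableSet_Ioi (g := fun x =>
      ((m : ℝ≥0∞) + 1) * min 1 (ENNReal.ofReal x)) fun x (hx : 0 < x) => ?_) ?_
    · rw [← ENNReal.ofReal_one, ← ENNReal.ofReal_min, ← ENNReal.ofReal_natCast,
        ← ENNReal.ofReal_add m.cast_nonneg zero_le_one, ← ENNReal.ofReal_mul (by positivity)]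
      refine ENNReal.ofReal_le_ofReal ?_
      -- `1 - e^{-mx}` is at most `1`, and at most `m x`.
      have h1 := Real.add_one_le_exp (-(m * x))
      have h2 := Real.exp_pos (-(m * x))
      have hm : (0 : ℝ) ≤ m := m.cast_nonneg
      rcases le_total 1 x with h | h
      · rw [min_eq_left h]; linarith
      · rw [min_eq_right h]; nlinarith
    · rw [lintegral_const_mul _ (by fun_prop)]
      exact ENNReal.mul_lt_top (by finiteness) hν.lintegral_min_lt_top
  have hint : Integrable (fun x => 1 - Real.exp (-(m * x))) (ν.restrict (Ioi 0)) := by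
    refine ⟨Continuous.aestronglyMeasurable (by fun_prop), ?_⟩
    rwa [hasFiniteIntegral_iff_ofReal hnn]
  rw [ofReal_integral_eq_lintegral_ofReal hint hnn]
  refine setLIntegral_congr_fun measurableSet_Ioi fun x (hx : 0 < x) => ?_
  rw [← ENNReal.ofReal_natCast, ← ENNReal.ofReal_mul m.cast_nonneg, expNeg_ofReal (by positivity),
    ENNReal.ofReal_sub _ (Real.exp_pos _).le, ENNReal.ofReal_one]

end IsLevyMeasureOnPos

/-! ### Poisson integrals and their laws -/

/-- The value in `[0, ∞]` of `α + ∫ G⁻¹ dX`, for the tail function `G` of `ν` and the Poisson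
process `X` of `poissonPoints`. -/
noncomputable def poissonIntegral (α : ℝ) (ν : Measure ℝ) (ω : PoissonSpace) : ℝ≥0∞ :=
  ENNReal.ofReal α + ∫⁻ y in Ioi 0, ENNReal.ofReal (tailInv ν y) ∂poissonPoints ω

lemma poissonIntegral_eq (α : ℝ) (ν : Measure ℝ) (ω : PoissonSpace) :
    poissonIntegral α ν ω = ENNReal.ofReal α +
      ∫⁻ y, ENNReal.ofReal ((Ioi 0).indicator (tailInv ν) y) ∂poissonPoints ω := by
  rw [poissonIntegral, ← lintegral_indicator measurableSet_Ioi]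
  congr 1
  refine lintegral_congr fun y => ?_
  by_cases hy : y ∈ Ioi (0 : ℝ) <;> simp [hy]

lemma measurable_poissonIntegral (α : ℝ) {ν : Measure ℝ} (hν : IsLevyMeasureOnPos ν) :
    Measurable (poissonIntegral α ν) := by
  simp_rw [funext (poissonIntegral_eq α ν)]
  exact measurable_const.add ((Measure.measurable_lintegral
    hν.measurable_indicator_tailInv.ennreal_ofReal).comp measurable_poissonPoints)

lemma poissonIntegral_mono {α₁ α₂ : ℝ} {ν₁ ν₂ : Measure ℝ} (h₁ : IsLevyMeasureOnPos ν₁)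
    (h₂ : IsLevyMeasureOnPos ν₂) (hα : α₁ ≤ α₂) (hν : TailLE ν₁ ν₂) (ω : PoissonSpace) :
    poissonIntegral α₁ ν₁ ω ≤ poissonIntegral α₂ ν₂ ω := by
  refine add_le_add (ENNReal.ofReal_le_ofReal hα) ?_
  refine setLIntegral_mono' measurableSet_Ioi fun y hy => ENNReal.ofReal_le_ofReal ?_
  by_contra! hlt
  have h := tailInv_nonneg ν₂ y
  exact lt_irrefl _ ((h₂.lt_tailInv_iff h hy).2
    (((h₁.lt_tailInv_iff h hy).1 hlt).trans_le (hν.measure_Ioi_le h)))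

lemma lintegral_expNeg_poissonIntegral (α : ℝ) {ν : Measure ℝ} (hν : IsLevyMeasureOnPos ν)
    (m : ℕ) : ∫⁻ ω, expNeg (m * poissonIntegral α ν ω) ∂poissonSpaceLaw =
      expNeg (m * ENNReal.ofReal α + ∫⁻ x in Ioi 0, (1 - expNeg (m * ENNReal.ofReal x)) ∂ν) := by
  have hf := hν.measurable_indicator_tailInv.ennreal_ofReal
  have h1 (ω : PoissonSpace) : expNeg (m * poissonIntegral α ν ω) =
      expNeg (m * ENNReal.ofReal α) * expNeg (∫⁻ y, m *
        ENNReal.ofReal ((Ioi 0).indicator (tailInv ν) y) ∂poissonPoints ω) := by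
    rw [poissonIntegral_eq, mul_add, expNeg_add, lintegral_const_mul _ hf]
  simp_rw [h1]
  rw [lintegral_const_mul' _ _ (expNeg_ne_top _),
    lintegral_expNeg_poissonPoints (hf.const_mul _), expNeg_add,
    ← hν.lintegral_one_sub_expNeg_tailInv m]
  congr 2
  exact setLIntegral_congr_fun measurableSet_Ioi fun y hy => by
    simp only [indicator_of_mem hy]

/-- The Lévy–Khinchin formula in terms of `[0, ∞]`-valued integrals. -/
lemma HasLevyKhinchin.lintegral_expNeg {P : Measure ℝ} {α : ℝ} {ν : Measure ℝ}
    [IsProbabilityMeasure P] (h : HasLevyKhinchin P α ν) (hP : P (Iio 0) = 0) (m : ℕ) :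
    ∫⁻ x, expNeg (m * ENNReal.ofReal x) ∂P =
      expNeg (m * ENNReal.ofReal α + ∫⁻ x in Ioi 0, (1 - expNeg (m * ENNReal.ofReal x)) ∂ν) := by
  have hnn : ∀ᵐ x ∂P, 0 ≤ x := by
    rw [ae_iff]
    simpa [Iio_def] using hP
  have hint : Integrable (fun x => Real.exp (-(m * x))) P := by
    refine .of_bound (C := 1)
      (by fun_prop : Continuous fun x : ℝ => Real.exp (-(m * x))).aestronglyMeasurable ?_
    filter_upwards [hnn] with x hx
    have : 0 ≤ (m : ℝ) * x := by positivity
    simpa using this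
  have hα := h.drift_nonneg
  have hI : 0 ≤ ∫ x in Ioi 0, (1 - Real.exp (-(m * x))) ∂ν := by
    refine setIntegral_nonneg measurableSet_Ioi fun x (hx : 0 < x) => ?_
    have : 0 ≤ (m : ℝ) * x := by positivity
    simpa using this
  rw [← h.isLevyMeasure.ofReal_integral_one_sub_exp, ← ENNReal.ofReal_natCast,
    ← ENNReal.ofReal_mul m.cast_nonneg, ← ENNReal.ofReal_add (by positivity) hI,
    expNeg_ofReal (by positivity), mul_comm (m : ℝ) α, ← h.neg_log_laplace m m.cast_nonneg, neg_neg,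
    Real.exp_log (integral_exp_pos hint),
    ofReal_integral_eq_lintegral_ofReal hint (.of_forall fun x => (Real.exp_pos _).le)]
  refine lintegral_congr_ae ?_
  filter_upwards [hnn] with x hx
  rw [← ENNReal.ofReal_mul m.cast_nonneg, expNeg_ofReal (by positivity)]

/-- The Poisson integral has the law with the given Lévy–Khinchin data; in particular it is almost
surely finite. -/
lemma map_poissonIntegral {P : Measure ℝ} {α : ℝ} {ν : Measure ℝ}
    [IsProbabilityMeasure P] (h : HasLevyKhinchin P α ν) (hP : P (Iio 0) = 0) :
    poissonSpaceLaw.map (poissonIntegral α ν) = P.map ENNReal.ofReal := by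
  have hW := measurable_poissonIntegral α h.isLevyMeasure
  have := Measure.isProbabilityMeasure_map (μ := poissonSpaceLaw) hW.aemeasurable
  have := Measure.isProbabilityMeasure_map (μ := P) ENNReal.measurable_ofReal.aemeasurable
  refine Measure.ext_of_lintegral_expNeg fun m => ?_
  have hm : Measurable fun x : ℝ≥0∞ => expNeg (m * x) := measurable_expNeg.comp (by fun_prop)
  rw [lintegral_map hm hW, lintegral_map hm ENNReal.measurable_ofReal, h.lintegral_expNeg hP,
    lintegral_expNeg_poissonIntegral α h.isLevyMeasure]

lemma ae_poissonIntegral_lt_top {P : Measure ℝ} {α : ℝ} {ν : Measure ℝ}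
    [IsProbabilityMeasure P] (h : HasLevyKhinchin P α ν) (hP : P (Iio 0) = 0) :
    ∀ᵐ ω ∂poissonSpaceLaw, poissonIntegral α ν ω < ∞ := by
  have hs : MeasurableSet {x : ℝ≥0∞ | x < ∞} := measurableSet_Iio
  rw [← ae_map_iff (measurable_poissonIntegral α h.isLevyMeasure).aemeasurable hs,
    map_poissonIntegral h hP, ae_map_iff ENNReal.measurable_ofReal.aemeasurable hs]
  simp

lemma hasLaw_toReal_poissonIntegral {P : Measure ℝ} {α : ℝ} {ν : Measure ℝ}
    [IsProbabilityMeasure P] (h : HasLevyKhinchin P α ν) (hP : P (Iio 0) = 0) :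
    HasLaw (fun ω => (poissonIntegral α ν ω).toReal) P poissonSpaceLaw := by
  have hW := measurable_poissonIntegral α h.isLevyMeasure
  refine ⟨hW.ennreal_toReal.aemeasurable, ?_⟩
  have hnn : ∀ᵐ x ∂P, 0 ≤ x := by
    rw [ae_iff]
    simpa [Iio_def] using hP
  change poissonSpaceLaw.map (ENNReal.toReal ∘ poissonIntegral α ν) = P
  rw [← Measure.map_map ENNReal.measurable_toReal hW, map_poissonIntegral h hP,
    Measure.map_map ENNReal.measurable_toReal ENNReal.measurable_ofReal]
  conv_rhs => rw [← Measure.map_id (μ := P)]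
  refine Measure.map_congr ?_
  filter_upwards [hnn] with x hx
  simp [hx]

lemma isPoissonIntegral_toReal_poissonIntegral {P : Measure ℝ} {α : ℝ} {ν : Measure ℝ}
    [IsProbabilityMeasure P] (h : HasLevyKhinchin P α ν) (hP : P (Iio 0) = 0) :
    IsPoissonIntegral poissonPoints poissonSpaceLaw α ν
      (fun ω => (poissonIntegral α ν ω).toReal) := by
  filter_upwards [ae_poissonIntegral_lt_top h hP] with ω hω
  have hm : AEStronglyMeasurable (tailInv ν) ((poissonPoints ω).restrict (Ioi 0)) :=
    ((aemeasurable_indicator_iff measurableSet_Ioi).1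
      h.isLevyMeasure.measurable_indicator_tailInv.aemeasurable).aestronglyMeasurable
  have hnn : ∀ᵐ y ∂(poissonPoints ω).restrict (Ioi 0), 0 ≤ tailInv ν y :=
    .of_forall (tailInv_nonneg ν)
  have hfin : ∫⁻ y in Ioi 0, ENNReal.ofReal (tailInv ν y) ∂poissonPoints ω < ∞ :=
    (ENNReal.add_lt_top.1 hω).2
  refine ⟨⟨hm, (hasFiniteIntegral_iff_ofReal hnn).2 hfin⟩, ?_⟩
  rw [poissonIntegral, ENNReal.toReal_add ENNReal.ofReal_ne_top hfin.ne,
    ENNReal.toReal_ofReal h.drift_nonneg, integral_eq_lintegral_of_nonneg_ae hnn hm]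

/-! ### The coupling -/

lemma StochLE.of_ae_le {Ω : Type*} [MeasurableSpace Ω] {μ : Measure Ω} {P Q : Measure ℝ}
    {X Y : Ω → ℝ} (hX : HasLaw X P μ) (hY : HasLaw Y Q μ) (h : ∀ᵐ ω ∂μ, X ω ≤ Y ω) :
    StochLE P Q := fun x => by
  have h1 := hX.measure_eq (p := fun z => x ≤ z) measurableSet_Ici
  have h2 := hY.measure_eq (p := fun z => x ≤ z) measurableSet_Ici
  change P {z | x ≤ z} ≤ Q {z | x ≤ z}
  rw [← h1, ← h2]
  refine measure_mono_ae ?_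
  filter_upwards [h] with ω hω hx
  exact le_trans hx hω

theorem lemma6p1 (P₁ P₂ : Measure ℝ) (α₁ α₂ : ℝ) (ν₁ ν₂ : Measure ℝ)
    (hP₁ : IsInfinitelyDivisibleNonneg P₁) (hP₂ : IsInfinitelyDivisibleNonneg P₂)
    (h₁ : HasLevyKhinchin P₁ α₁ ν₁) (h₂ : HasLevyKhinchin P₂ α₂ ν₂)
    (hα : α₁ ≤ α₂) (hν : TailLE ν₁ ν₂) :
    (∃ (Ω : Type) (_ : MeasurableSpace Ω) (μ : Measure Ω) (_ : IsProbabilityMeasure μ)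
      (X : Ω → Measure ℝ) (Z₁ Z₂ : Ω → ℝ),
      Measurable Z₁ ∧ Measurable Z₂ ∧ HasLaw Z₁ P₁ μ ∧ HasLaw Z₂ P₂ μ ∧
      (∀ᵐ ω ∂μ, Z₁ ω ≤ Z₂ ω) ∧
      IsUnitPoissonPointProcess X μ ∧
      IsPoissonIntegral X μ α₁ ν₁ Z₁ ∧ IsPoissonIntegral X μ α₂ ν₂ Z₂) ∧
    StochLE P₁ P₂ := by
  have := hP₁.isProbabilityMeasure
  have := hP₂.isProbabilityMeasure
  have hZ₁ := hasLaw_toReal_poissonIntegral h₁ hP₁.nonneg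
  have hZ₂ := hasLaw_toReal_poissonIntegral h₂ hP₂.nonneg
  have hle : ∀ᵐ ω ∂poissonSpaceLaw,
      (poissonIntegral α₁ ν₁ ω).toReal ≤ (poissonIntegral α₂ ν₂ ω).toReal := by
    -- Finiteness of the larger integral matters, since `toReal` sends `∞` to `0`.
    filter_upwards [ae_poissonIntegral_lt_top h₂ hP₂.nonneg] with ω hω
    exact ENNReal.toReal_mono hω.ne
      (poissonIntegral_mono h₁.isLevyMeasure h₂.isLevyMeasure hα hν ω)
  exact ⟨⟨PoissonSpace, inferInstance, poissonSpaceLaw, inferInstance, poissonPoints, _, _,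
    (measurable_poissonIntegral α₁ h₁.isLevyMeasure).ennreal_toReal,
    (measurable_poissonIntegral α₂ h₂.isLevyMeasure).ennreal_toReal, hZ₁, hZ₂, hle,
    isUnitPoissonPointProcess_poissonPoints,
    isPoissonIntegral_toReal_poissonIntegral h₁ hP₁.nonneg,
    isPoissonIntegral_toReal_poissonIntegral h₂ hP₂.nonneg⟩, .of_ae_le hZ₁ hZ₂ hle⟩
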